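/- All matrices are complex. **Deformations.** A deformation of an $N\times N$ matrix $A$ is a matrix function $\mathcal A(\alpha_1,\dots,\alpha_k)$ of parameters that is holomorphic at $0$ and equals $A$ at $0$. It is versal if there are a matrix function $\mathcal S(E)$ and functions $h_1(E),\dots,h_k(E)$ of the entries of an $N\times N$ matrix $E$, holomorphic at $E=0$, with $\mathcal S(0)=I$ and $h_i(0)=0$, such that $\mathcal A(h_1(E),\dots,h_k(E))=\mathcal S(E)^{-1}(A+E)\mathcal S(E)$ for all $E$ in a neighborhood of $0$. It is miniversal if it is versal and no versal deformation of $A$ has fewer parameters. A deformation $A+\mathcal B(\alpha_1,\dots,\alpha_k)$ is simple if $k$ entries of $\mathcal B$ are the independent parameters $\alpha_1,\dots,\alpha_k$ and the other entries are zero. A simple deformation is block triangular with respect to a partition of $A$ into blocks (the same strips of consecutive rows and of consecutive columns) if $\mathcal B$ is block triangular with respect to this partition and each block of $\mathcal B$ is either $0$ or has only independent parameters as entries. **Jordan and Weyr matrices.** Let $J(\lambda)=J_{n_1}(\lambda)\oplus\dots\oplus J_{n_l}(\lambda)$ with $n_1\ge\dots\ge n_l\ge 1$, where $J_r(\lambda)$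 is the $r\times r$ Jordan block with units over the diagonal. Let $\mathcal H=[\mathcal T_{n_i,n_j}]_{i,j=1}^{l}$, where $\mathcal T_{pq}$ is the $p\times q$ matrix whose first column if $p<q$, and whose last row if $p\ge q$, consists of independent parameters, and whose other entries are $0$; the parameters of different blocks are independent. Apply to the rows and columns of $J(\lambda)$ and of $\mathcal H$ the same permutation: put first the first columns of $J_{n_1}(\lambda),\dots,J_{n_l}(\lambda)$ (in this order), next the second columns of all blocks of size at least $2$ (in this order), and so on, and permute the rows correspondingly. Denote the obtained matrices by $J(\lambda)^{\#}$ and $\mathcal H^{\#}$. For $J=J(\lambda_1)\oplus\dots\oplus J(\lambda_\tau)$ with distinct $\lambda_1,\dots,\lambda_\tau$ and each $J(\lambda_i)$ of the above form, the Weyr canonical form is $J^{\#}=J(\lambda_1)^{\#}\oplus\dots\oplus J(\lambda_\tau)^{\#}$. **Theorem.** (i) $J(\lambda)^{\#}+\mathcal H^{\#}$ is a miniversal deformation of $J(\lambda)^{\#}$. There is a coarsest partition of $J(\lambda)^{\#}$ for which all diagonal blocks are scalar matrices and each off-diagonal block is $0$ or an identity matrix, and $\mathcal H^{\#}$ is lower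 block triangular with respect to it. (ii) Let $\mathcal H_i^{\#}$ be the parameter matrix constructed as above for $J(\lambda_i)$, the parameters for different $i$ being independent. Then $$J^{\#}+\mathcal K^{\#}:=(J(\lambda_1)^{\#}+\mathcal H_1^{\#})\oplus\dots\oplus(J(\lambda_\tau)^{\#}+\mathcal H_\tau^{\#})$$ is a simple miniversal deformation of $J^{\#}$. There is a coarsest partition of $J^{\#}$ for which all diagonal blocks are scalar matrices and each off-diagonal block is $0$ or an identity matrix, and the deformation $J^{\#}+\mathcal K^{\#}$ is (lower) block triangular with respect to it. -/

import Mathlib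

open Topology

section Deformations

attribute [local instance] Matrix.normedAddCommGroup Matrix.normedSpace

variable {m ι : Type*} [Fintype m] [DecidableEq m] [Fintype ι]

/-- A deformation of `A` with parameters indexed by `ι`: a matrix function of the parameters that is
holomorphic at `0` and equals `A` at `0` (only its germ at `0` matters below). -/
def IsDeformation (A : Matrix m m ℂ) (D : (ι → ℂ) → Matrix m m ℂ) : Prop :=
  AnalyticAt ℂ D 0 ∧ D 0 = A

/-- A deformation `D` of `A` is versal if all matrices `A + E` near `A` are reduced to the form
`D (h E) = (S E)⁻¹ (A + E) (S E)`, where `S` and `h` are holomorphic at `0`, `S 0 = I`, `h 0 = 0`.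
(Near `0` the matrix `S E` is invertible because `S` is continuous at `0` and `S 0 = I`.) -/
def IsVersal (A : Matrix m m ℂ) (D : (ι → ℂ) → Matrix m m ℂ) : Prop :=
  IsDeformation A D ∧
    ∃ (S : Matrix m m ℂ → Matrix m m ℂ) (h : Matrix m m ℂ → ι → ℂ),
      AnalyticAt ℂ S 0 ∧ S 0 = 1 ∧ AnalyticAt ℂ h 0 ∧ h 0 = 0 ∧
        ∀ᶠ E in 𝓝 (0 : Matrix m m ℂ), D (h E) = (S E)⁻¹ * (A + E) * S E

/-- A miniversal deformation is a versal one with the minimal number of parameters. -/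
def IsMiniversal (A : Matrix m m ℂ) (D : (ι → ℂ) → Matrix m m ℂ) : Prop :=
  IsVersal A D ∧
    ∀ (k : ℕ) (D' : (Fin k → ℂ) → Matrix m m ℂ), IsVersal A D' → Fintype.card ι ≤ k

end Deformations

section Shape

variable {m ι : Type*}

/-- `D = A + B(α)` where the entries of `B(α)` at the (distinct) positions `pos t` are the
independent parameters `α t`, and all the other entries of `B(α)` are zero. -/
def IsSimpleAt (A : Matrix m m ℂ) (D : (ι → ℂ) → Matrix m m ℂ) (pos : ι ↪ m × m) : Prop :=
  ∀ α : ι → ℂ, (∀ t, (D α - A) (pos t).1 (pos t).2 = α t) ∧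
    ∀ p q, (p, q) ∉ Set.range pos → (D α - A) p q = 0

/-- A simple deformation. -/
def IsSimple (A : Matrix m m ℂ) (D : (ι → ℂ) → Matrix m m ℂ) : Prop :=
  ∃ pos : ι ↪ m × m, IsSimpleAt A D pos

/-- Lower block triangularity. A partition of a square matrix into blocks (strips of consecutive
rows and the same strips of consecutive columns) is given by a monotone labelling `b : m → ℕ` of the
linearly ordered index set: the strip `u` consists of the indices `p` with `b p = u`. -/
def IsLowerBlockTriangular (b : m → ℕ) (B : Matrix m m ℂ) : Prop :=
  ∀ p q, b p < b q → B p q = 0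

/-- A simple deformation that is (lower) block triangular with respect to the partition `b`, each
block of the deforming matrix being either zero or filled entirely with independent parameters. -/
def IsSimpleLowerBlockTriangular (b : m → ℕ) (A : Matrix m m ℂ) (D : (ι → ℂ) → Matrix m m ℂ) :
    Prop :=
  ∃ pos : ι ↪ m × m, IsSimpleAt A D pos ∧
    (∀ α, IsLowerBlockTriangular b (D α - A)) ∧
    ∀ u v : ℕ, (∀ p q, b p = u → b q = v → (p, q) ∉ Set.range pos) ∨
      (∀ p q, b p = u → b q = v → (p, q) ∈ Set.range pos)

variable [LinearOrder m]

/-- `b` is a partition of `A` into blocks for which every diagonal block is a scalar matrix and every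
off-diagonal block is zero or an identity matrix (of the same size in rows and columns). -/
def IsScalarIdentityPartition (A : Matrix m m ℂ) (b : m → ℕ) : Prop :=
  Monotone b ∧
  (∀ u : ℕ, ∃ c : ℂ, ∀ p q, b p = u → b q = u → A p q = if p = q then c else 0) ∧
  ∀ u v : ℕ, u ≠ v →
    (∀ p q, b p = u → b q = v → A p q = 0) ∨
    ∃ e : {p // b p = u} ≃o {q // b q = v},
      ∀ (p : {p // b p = u}) (q : {q // b q = v}), A p q = if e p = q then 1 else 0

/-- `b` is the coarsest such partition: every other one refines it. -/
def IsCoarsestPartition (A : Matrix m m ℂ) (b : m → ℕ) : Prop :=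
  IsScalarIdentityPartition A b ∧
    ∀ b', IsScalarIdentityPartition A b' → ∀ p q, b' p = b' q → b p = b q

end Shape

section JordanWeyr

/-- The Jordan block of size `r`, with the units over the diagonal. -/
def jordanBlock (r : ℕ) (lam : ℂ) : Matrix (Fin r) (Fin r) ℂ :=
  Matrix.of fun a b => if a = b then lam else if (a : ℕ) + 1 = b then 1 else 0

/-- Positions in a Jordan matrix with blocks of sizes `n 0, n 1, …`: `⟨i, a⟩` is the
`a`-th row (column) of the `i`-th block. -/
abbrev JordanIdx {l : ℕ} (n : Fin l → ℕ) : Type := Σ i : Fin l, Fin (n i)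

/-- `J(λ) = J_{n 0}(λ) ⊕ J_{n 1}(λ) ⊕ ⋯`. -/
def jordanMatrix {l : ℕ} (n : Fin l → ℕ) (lam : ℂ) : Matrix (JordanIdx n) (JordanIdx n) ℂ :=
  Matrix.blockDiagonal' fun i => jordanBlock (n i) lam

/-- The positions of the stars of the `p × q` matrix `T_{pq}`: its first column if `p < q`, its last
row if `p ≥ q`. -/
def IsStarT (p q : ℕ) (a : Fin p) (b : Fin q) : Prop :=
  if p < q then (b : ℕ) = 0 else (a : ℕ) + 1 = p

instance (p q : ℕ) (a : Fin p) (b : Fin q) : Decidable (IsStarT p q a b) := by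
  unfold IsStarT; infer_instance

/-- The positions of the stars of the block matrix `H = [T_{n i, n j}]`; they index the independent
parameters. -/
abbrev Stars {l : ℕ} (n : Fin l → ℕ) : Type :=
  {t : JordanIdx n × JordanIdx n // IsStarT (n t.1.1) (n t.2.1) t.1.2 t.2.2}

/-- The parameter matrix `H = [T_{n i, n j}]`, with the parameters `α` in place of the stars. -/
def arnoldMatrix {l : ℕ} (n : Fin l → ℕ) (α : Stars n → ℂ) :
    Matrix (JordanIdx n) (JordanIdx n) ℂ :=
  Matrix.of fun x y =>
    if h : IsStarT (n x.1) (n y.1) x.2 y.2 then α ⟨(x, y), h⟩ else 0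

/-- Positions in the Weyr matrix, in lexicographic order: first the first columns of
all Jordan blocks (in the order of the blocks), next the second columns of all blocks of size at
least two, and so on; `⟨j, i⟩` comes from the `j`-th column of the `i`-th block. -/
abbrev WeyrIdx {l : ℕ} (n : Fin l → ℕ) : Type :=
  Σₗ j : Fin (Finset.univ.sup n), {i : Fin l // (j : ℕ) < n i}

/-- The permutation of rows and columns that transforms a Jordan matrix with a single eigenvalue to
its Weyr form. -/
def weyrPerm {l : ℕ} (n : Fin l → ℕ) : JordanIdx n ≃ WeyrIdx n where
  toFun x := toLex ⟨⟨x.2, x.2.2.trans_le (Finset.le_sup (f := n) (Finset.mem_univ x.1))⟩,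
    ⟨x.1, x.2.2⟩⟩
  invFun y := ⟨(ofLex y).2.1, ⟨(ofLex y).1, (ofLex y).2.2⟩⟩
  left_inv _ := rfl
  right_inv _ := rfl

/-- `J(λ)^#`. -/
def weyrMatrix {l : ℕ} (n : Fin l → ℕ) (lam : ℂ) : Matrix (WeyrIdx n) (WeyrIdx n) ℂ :=
  Matrix.reindex (weyrPerm n) (weyrPerm n) (jordanMatrix n lam)

/-- `H^#`. -/
def weyrArnoldMatrix {l : ℕ} (n : Fin l → ℕ) (α : Stars n → ℂ) :
    Matrix (WeyrIdx n) (WeyrIdx n) ℂ :=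
  Matrix.reindex (weyrPerm n) (weyrPerm n) (arnoldMatrix n α)

/-- Positions in a direct sum of Weyr matrices, in their natural (lexicographic) order. -/
abbrev WeyrSumIdx {τ : ℕ} {l : Fin τ → ℕ} (n : ∀ a, Fin (l a) → ℕ) : Type :=
  Σₗ a : Fin τ, WeyrIdx (n a)

/-- The direct sum of square matrices indexed by the positions of Weyr matrices. -/
def weyrDirectSum {τ : ℕ} {l : Fin τ → ℕ} (n : ∀ a, Fin (l a) → ℕ)
    (M : ∀ a, Matrix (WeyrIdx (n a)) (WeyrIdx (n a)) ℂ) :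
    Matrix (WeyrSumIdx n) (WeyrSumIdx n) ℂ :=
  Matrix.reindex toLex toLex (Matrix.blockDiagonal' M)

/-- The Weyr canonical form `J^# = J(λ₁)^# ⊕ ⋯ ⊕ J(λ_τ)^#`. -/
def weyrForm {τ : ℕ} {l : Fin τ → ℕ} (n : ∀ a, Fin (l a) → ℕ) (lam : Fin τ → ℂ) :
    Matrix (WeyrSumIdx n) (WeyrSumIdx n) ℂ :=
  weyrDirectSum n fun a => weyrMatrix (n a) (lam a)

/-- The direct sum `(J(λ₁)^# + H₁^#) ⊕ ⋯ ⊕ (J(λ_τ)^# + H_τ^#)`; the parameters of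
different summands are independent. -/
def weyrDeformation {τ : ℕ} {l : Fin τ → ℕ} (n : ∀ a, Fin (l a) → ℕ) (lam : Fin τ → ℂ)
    (α : (Σ a, Stars (n a)) → ℂ) : Matrix (WeyrSumIdx n) (WeyrSumIdx n) ℂ :=
  weyrDirectSum n fun a =>
    weyrMatrix (n a) (lam a) + weyrArnoldMatrix (n a) fun t => α ⟨a, t⟩

end JordanWeyr

/-! Versality is an infinitesimal condition. The map `(X, α) ↦ (1 + X)(A + B α)(1 + X)⁻¹ - A` has
derivative `X A - A X + B α` at `0`; if this is onto, a holomorphic right inverse gives the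
reduction (`isVersal_of_span`). Conversely, differentiating the versality identity shows that the
derivative of any versal deformation spans all matrices modulo commutators with `A`
(`IsVersal.exists_linear`). Hence a linear complement to the commutators is miniversal
(`isMiniversal_of_complement`).

For a direct sum of Jordan blocks the commutator splits into independent two-term shift equations
along diagonals, with an extra term `c * X a b` when the eigenvalues differ by `c`. They can be
solved outside the stars (`exists_sylvester_eq`), and a commutator vanishing outside the stars
vanishes (`sylvester_eq_zero_of_isStarT`). A simultaneous permutation changes nothing, so the Weyr
form inherits the result.

The strips are the classes of positions with the same eigenvalue, column number and block size
(`weyrKey`). Passing to the next column carries strips onto strips, which gives the identity blocks.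
In any other admissible partition the identity blocks must also carry strips along this shift, so
members of a strip have equally many columns to their left and to their right
(`IsScalarIdentityPartition.weyrKey_eq`). Stars depend only on keys and never lie above the diagonal
strips. -/

/-! ### Holomorphic right inverses -/

section RightInverse

variable {V E : Type*} [NormedAddCommGroup V] [NormedSpace ℂ V] [NormedAddCommGroup E]
  [NormedSpace ℂ E] [FiniteDimensional ℂ E]

/-- A map with surjective derivative has a local holomorphic right inverse. -/
theorem exists_analyticAt_rightInverse {f : V → E} {f' : V →L[ℂ] E} (hf : AnalyticAt ℂ f 0)
    (hf' : HasFDerivAt f f' 0) (h0 : f 0 = 0) (hsurj : Function.Surjective f') :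
    ∃ g : E → V, AnalyticAt ℂ g 0 ∧ g 0 = 0 ∧ ∀ᶠ y in 𝓝 (0 : E), f (g y) = y := by
  have : CompleteSpace E := FiniteDimensional.complete ℂ E
  -- Restricting `f` along a linear right inverse of `f'` makes the derivative the identity of `E`,
  -- so the ordinary inverse function theorem applies.
  obtain ⟨R, hR⟩ := (f' : V →ₗ[ℂ] E).exists_rightInverse_of_surjective
    (LinearMap.range_eq_top.2 hsurj)
  let R' : E →L[ℂ] V := LinearMap.toContinuousLinearMap R
  have hR' : ∀ y, f' (R' y) = y := fun y => LinearMap.congr_fun hR y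
  have hR0 : R' 0 = 0 := map_zero R'
  have hfR : AnalyticAt ℂ (f ∘ R') 0 := by
    refine AnalyticAt.comp ?_ (R'.analyticAt 0)
    rwa [hR0]
  have hder : HasFDerivAt (f ∘ R') (ContinuousLinearMap.id ℂ E) 0 := by
    have h1 : HasFDerivAt f f' (R' 0) := by rwa [hR0]
    have h2 := h1.comp (0 : E) R'.hasFDerivAt
    convert h2 using 1
    ext y
    simp [hR']
  have hstrict : HasStrictFDerivAt (f ∘ R')
      ((ContinuousLinearEquiv.refl ℂ E : E ≃L[ℂ] E) : E →L[ℂ] E) 0 := by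
    have h := hfR.hasStrictFDerivAt
    rw [hder.fderiv] at h
    exact h
  have hfR0 : (f ∘ R') 0 = 0 := by simp [hR0, h0]
  let Φ := hstrict.toOpenPartialHomeomorph
  have hsrc : (0 : E) ∈ Φ.source := hstrict.mem_toOpenPartialHomeomorph_source
  have hΦ : ∀ y, Φ y = f (R' y) := fun y => rfl
  have hΦ0 : Φ 0 = 0 := hfR0
  have hsymm : AnalyticAt ℂ Φ.symm 0 := by
    have := Φ.analyticAt_symm' (i := ContinuousLinearEquiv.refl ℂ E) hsrc hfR
      hstrict.hasFDerivAt.fderiv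
    rwa [hΦ0] at this
  have hsymm0 : Φ.symm 0 = 0 := by
    have := Φ.left_inv hsrc
    rwa [hΦ0] at this
  refine ⟨fun y => R' (Φ.symm y), ?_, ?_, ?_⟩
  · exact (R'.analyticAt _).comp hsymm
  · simp only [hsymm0, hR0]
  · have hmem : Φ.target ∈ 𝓝 (0 : E) := by
      have := Φ.map_source hsrc
      rw [hΦ0] at this
      exact Φ.open_target.mem_nhds this
    filter_upwards [hmem] with y hy
    rw [← hΦ]
    exact Φ.right_inv hy

end RightInverse

/-! ### Infinitesimal criteria for versality and miniversality -/

section MatrixAnalysis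

attribute [local instance] Matrix.normedAddCommGroup Matrix.normedSpace

variable {m ι : Type*} [Fintype m] [DecidableEq m] [Fintype ι]
variable {V : Type*} [NormedAddCommGroup V] [NormedSpace ℂ V]

/-- Multiplication of square matrices as a continuous bilinear map. -/
noncomputable def Matrix.mulContinuous (m : Type*) [Fintype m] [DecidableEq m] :
    Matrix m m ℂ →L[ℂ] Matrix m m ℂ →L[ℂ] Matrix m m ℂ :=
  LinearMap.toContinuousLinearMap
    ((LinearMap.toContinuousLinearMap (𝕜 := ℂ) (E := Matrix m m ℂ) (F' := Matrix m m ℂ)).toLinearMap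
      ∘ₗ LinearMap.mul ℂ (Matrix m m ℂ))

theorem AnalyticAt.matrix_mul {f g : V → Matrix m m ℂ} {x : V} (hf : AnalyticAt ℂ f x)
    (hg : AnalyticAt ℂ g x) : AnalyticAt ℂ (fun y => f y * g y) x :=
  ((Matrix.mulContinuous m).analyticAt_bilinear (f x, g x)).comp₂ hf hg

theorem HasFDerivAt.matrix_mul {f g : V → Matrix m m ℂ} {f' g' : V →L[ℂ] Matrix m m ℂ} {x : V}
    (hf : HasFDerivAt f f' x) (hg : HasFDerivAt g g' x) :
    ∃ F' : V →L[ℂ] Matrix m m ℂ, HasFDerivAt (fun y => f y * g y) F' x ∧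
      ∀ v, F' v = f x * g' v + f' v * g x :=
  ⟨_, (Matrix.mulContinuous m).hasFDerivAt_of_bilinear hf hg, fun _ => rfl⟩

omit [DecidableEq m] in
theorem AnalyticAt.matrix_apply {f : V → Matrix m m ℂ} {x : V} (hf : AnalyticAt ℂ f x) (p q : m) :
    AnalyticAt ℂ (fun y => f y p q) x :=
  analyticAt_pi_iff.1 (analyticAt_pi_iff.1 hf p) q

omit [DecidableEq m] in
theorem AnalyticAt.of_matrix_apply {f : V → Matrix m m ℂ} {x : V}
    (hf : ∀ p q, AnalyticAt ℂ (fun y => f y p q) x) : AnalyticAt ℂ f x :=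
  analyticAt_pi_iff.2 fun p => analyticAt_pi_iff.2 fun q => hf p q

theorem AnalyticAt.matrix_det {f : V → Matrix m m ℂ} {x : V} (hf : AnalyticAt ℂ f x) :
    AnalyticAt ℂ (fun y => (f y).det) x := by
  simp only [Matrix.det_apply']
  refine Finset.analyticAt_fun_sum _ fun σ _ => analyticAt_const.mul ?_
  exact Finset.analyticAt_fun_prod _ fun i _ => hf.matrix_apply _ _

/-- By Cramer's rule each entry is a determinant, with one row of `f y` replaced by a constant row,
divided by `det (f y)`. -/
theorem AnalyticAt.matrix_inv {f : V → Matrix m m ℂ} {x : V} (hf : AnalyticAt ℂ f x)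
    (hx : (f x).det ≠ 0) : AnalyticAt ℂ (fun y => (f y)⁻¹) x := by
  refine AnalyticAt.of_matrix_apply fun p q => ?_
  simp only [Matrix.inv_def, Ring.inverse_eq_inv', Matrix.smul_apply, smul_eq_mul,
    Matrix.adjugate_apply]
  refine (hf.matrix_det.inv hx).mul (AnalyticAt.matrix_det (AnalyticAt.of_matrix_apply ?_))
  intro a b
  by_cases h : a = q
  · subst h
    simpa using analyticAt_const
  · simpa [Matrix.updateRow_ne h] using hf.matrix_apply a b

theorem eventually_matrix_det_ne_zero {f : V → Matrix m m ℂ} (hf : AnalyticAt ℂ f 0)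
    (h0 : f 0 = 1) : ∀ᶠ y in 𝓝 (0 : V), (f y).det ≠ 0 :=
  hf.matrix_det.continuousAt.eventually_ne (by simp [h0])

/-- If the values of `B` together with the commutators `X A - A X` span all matrices, then `A + B`
is versal. -/
theorem isVersal_of_span (A : Matrix m m ℂ) (B : (ι → ℂ) →ₗ[ℂ] Matrix m m ℂ)
    (hspan : ∀ E, ∃ X α, X * A - A * X + B α = E) : IsVersal A fun α => A + B α := by
  let B' : (ι → ℂ) →L[ℂ] Matrix m m ℂ := LinearMap.toContinuousLinearMap B
  have hB' : ∀ α, B' α = B α := fun _ => rfl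
  refine ⟨⟨analyticAt_const.add (B'.analyticAt 0), by simp⟩, ?_⟩
  let P : Matrix m m ℂ × (ι → ℂ) → Matrix m m ℂ := fun z => 1 + z.1
  let Q : Matrix m m ℂ × (ι → ℂ) → Matrix m m ℂ := fun z => A + B' z.2
  have hP : AnalyticAt ℂ P 0 := analyticAt_const.add analyticAt_fst
  have hQ : AnalyticAt ℂ Q 0 := analyticAt_const.add ((B'.analyticAt _).comp analyticAt_snd)
  have hP0 : P 0 = 1 := by simp [P]
  have hQ0 : Q 0 = A := by simp [Q]
  have hP' : HasFDerivAt P (ContinuousLinearMap.fst ℂ (Matrix m m ℂ) (ι → ℂ)) 0 :=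
    hasFDerivAt_fst.const_add 1
  have hQ' : HasFDerivAt Q (B'.comp (ContinuousLinearMap.snd ℂ (Matrix m m ℂ) (ι → ℂ))) 0 :=
    (B'.hasFDerivAt.comp _ hasFDerivAt_snd).const_add A
  -- Solving `F z = E` is the versality identity with `S = P z`.
  let F : Matrix m m ℂ × (ι → ℂ) → Matrix m m ℂ := fun z => P z * Q z * (P z)⁻¹ - A
  have hF : AnalyticAt ℂ F 0 :=
    ((hP.matrix_mul hQ).matrix_mul (hP.matrix_inv (by simp [hP0]))).sub analyticAt_const
  have hF0 : F 0 = 0 := by simp [F, hP0, hQ0]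
  -- Clearing the inverse allows the derivative of `F` to be found by the product rule alone.
  have hFeq : ∀ᶠ z in 𝓝 0, F z * P z = P z * Q z - A * P z := by
    filter_upwards [eventually_matrix_det_ne_zero hP hP0] with z hz
    simp only [F, sub_mul]
    rw [Matrix.nonsing_inv_mul_cancel_right _ _ (isUnit_iff_ne_zero.2 hz)]
  have hF' := hF.differentiableAt.hasFDerivAt
  obtain ⟨L₁, hL₁, hL₁v⟩ := hF'.matrix_mul hP'
  obtain ⟨L₂, hL₂, hL₂v⟩ := hP'.matrix_mul hQ'
  obtain ⟨L₃, hL₃, hL₃v⟩ := (hasFDerivAt_const A (0 : Matrix m m ℂ × (ι → ℂ))).matrix_mul hP'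
  have hL := ((hL₂.sub hL₃).congr_of_eventuallyEq hFeq).unique hL₁
  have halg : ∀ l₁ l₂ l₃ f X b : Matrix m m ℂ, l₂ - l₃ = l₁ → l₁ = 0 * X + f * 1 →
      l₂ = 1 * b + X * A → l₃ = A * X + 0 * 1 → f = X * A - A * X + b := by
    rintro _ _ _ f X b h rfl rfl rfl
    simp only [zero_mul, mul_one, one_mul, zero_add, add_zero] at h
    rw [← h]
    abel
  have hval : ∀ X α, fderiv ℂ F 0 (X, α) = X * A - A * X + B α := by
    intro X α
    have e₁ := hL₁v (X, α)
    have e₂ := hL₂v (X, α)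
    have e₃ := hL₃v (X, α)
    rw [hF0, hP0] at e₁
    rw [hP0, hQ0] at e₂
    rw [hP0] at e₃
    exact halg _ _ _ _ _ _ (congrArg (fun L => L (X, α)) hL) e₁ e₂ e₃
  obtain ⟨G, hG, hG0, hFG⟩ := exists_analyticAt_rightInverse hF hF' hF0 (fun E => by
    obtain ⟨X, α, h⟩ := hspan E
    exact ⟨(X, α), (hval X α).trans h⟩)
  have hPG : AnalyticAt ℂ (fun E => P (G E)) 0 := by
    refine AnalyticAt.comp (g := P) ?_ hG
    rwa [hG0]
  refine ⟨fun E => P (G E), fun E => (G E).2, hPG, by simp [hG0, hP0],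
    AnalyticAt.comp (g := Prod.snd) analyticAt_snd hG, by simp [hG0], ?_⟩
  filter_upwards [hFG, eventually_matrix_det_ne_zero hPG (by simp [hG0, hP0])] with E hE hdet
  have hu := isUnit_iff_ne_zero.2 hdet
  have h1 : A + E = P (G E) * Q (G E) * (P (G E))⁻¹ :=
    (sub_eq_iff_eq_add'.1 hE).symm
  have h2 : Q (G E) = (P (G E))⁻¹ * (A + E) * P (G E) := by
    rw [h1, Matrix.mul_assoc (P (G E)), Matrix.nonsing_inv_mul_cancel_left _ _ hu,
      Matrix.nonsing_inv_mul_cancel_right _ _ hu]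
  exact h2

/-- The infinitesimal form of versality. -/
theorem IsVersal.exists_linear {A : Matrix m m ℂ} {D : (ι → ℂ) → Matrix m m ℂ}
    (hD : IsVersal A D) :
    ∃ L : (ι → ℂ) →ₗ[ℂ] Matrix m m ℂ, ∀ E, ∃ X α, X * A - A * X + L α = E := by
  obtain ⟨⟨hDa, hD0⟩, S, h, hS, hS0, hh, hh0, heq⟩ := hD
  have hS' := hS.differentiableAt.hasFDerivAt
  have hDh : HasFDerivAt (fun E => D (h E)) ((fderiv ℂ D 0).comp (fderiv ℂ h 0)) 0 := by
    refine HasFDerivAt.comp (g := D) 0 ?_ hh.differentiableAt.hasFDerivAt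
    rw [hh0]
    exact hDa.differentiableAt.hasFDerivAt
  have heq' : ∀ᶠ E in 𝓝 0, S E * D (h E) = (A + E) * S E := by
    filter_upwards [heq, eventually_matrix_det_ne_zero hS hS0] with E hE hdet
    rw [hE, ← Matrix.mul_assoc,
      Matrix.mul_nonsing_inv_cancel_left _ _ (isUnit_iff_ne_zero.2 hdet)]
  obtain ⟨L₁, hL₁, hL₁v⟩ := hS'.matrix_mul hDh
  obtain ⟨L₂, hL₂, hL₂v⟩ := ((hasFDerivAt_id (𝕜 := ℂ) (0 : Matrix m m ℂ)).const_add A).matrix_mul hS'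
  have hL := (hL₂.congr_of_eventuallyEq heq').unique hL₁
  refine ⟨(fderiv ℂ D 0 : (ι → ℂ) →ₗ[ℂ] Matrix m m ℂ), fun E => ⟨fderiv ℂ S 0 E, fderiv ℂ h 0 E, ?_⟩⟩
  have halg : ∀ l₁ l₂ X d : Matrix m m ℂ, l₂ = l₁ → l₁ = 1 * d + X * A →
      l₂ = (A + 0) * X + E * 1 → X * A - A * X + d = E := by
    rintro _ _ X d rfl h h'
    simp only [mul_one, one_mul, add_zero] at h h'
    rw [← sub_eq_iff_eq_add'.2 h', h]
    abel
  have e₁ := hL₁v E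
  have e₂ := hL₂v E
  rw [hS0, hh0, hD0] at e₁
  rw [hS0] at e₂
  exact halg _ _ _ _ (congrArg (fun L => L E) hL) e₁ e₂

/-- If the values of `B` form a complement to the space of the commutators `X A - A X`, then `A + B`
is miniversal. -/
theorem isMiniversal_of_complement (A : Matrix m m ℂ) (B : (ι → ℂ) →ₗ[ℂ] Matrix m m ℂ)
    (hspan : ∀ E, ∃ X α, X * A - A * X + B α = E)
    (hindep : ∀ X α, X * A - A * X = B α → α = 0) : IsMiniversal A fun α => A + B α := by
  refine ⟨isVersal_of_span A B hspan, fun k D' hD' => ?_⟩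
  obtain ⟨L, hL⟩ := hD'.exists_linear
  -- Modulo the commutators `W`, `B` is injective and the linearization `L` of any versal
  -- deformation is surjective; comparing dimensions bounds the number of parameters.
  let W : Submodule ℂ (Matrix m m ℂ) :=
    LinearMap.range (LinearMap.mulRight ℂ A - LinearMap.mulLeft ℂ A)
  have h1 : Function.Injective (W.mkQ ∘ₗ B) := by
    rw [← LinearMap.ker_eq_bot, LinearMap.ker_eq_bot']
    intro α hα
    rw [LinearMap.comp_apply, Submodule.mkQ_apply, Submodule.Quotient.mk_eq_zero] at hα
    obtain ⟨X, hX⟩ := hα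
    exact hindep X α (by simpa using hX)
  have h2 : Function.Surjective (W.mkQ ∘ₗ L) := by
    intro y
    obtain ⟨E, rfl⟩ := W.mkQ_surjective y
    obtain ⟨X, α, rfl⟩ := hL E
    refine ⟨α, ?_⟩
    rw [map_add, LinearMap.comp_apply, right_eq_add, Submodule.mkQ_apply,
      Submodule.Quotient.mk_eq_zero]
    exact ⟨X, by simp⟩
  have h3 := LinearMap.finrank_le_finrank_of_injective h1
  have h4 := LinearMap.finrank_le_finrank_of_surjective h2
  simpa using h3.trans h4

end MatrixAnalysis

/-! ### The commutator equation for a pair of Jordan blocks -/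

section SylvesterRecursion

/-- The commutator with Jordan blocks, `X J_q(μ') - J_p(μ) X`, for infinite arrays `X` and
`c = μ' - μ`. -/
def sylvester (c : ℂ) (X : ℕ → ℕ → ℂ) (a b : ℕ) : ℂ :=
  c * X a b + (if b = 0 then 0 else X a (b - 1)) - X (a + 1) b

/-- Rows are found upward from the zero row `p`, and each row from left to right by dividing by `c`;
`Z d` is the row `p - d`. -/
theorem exists_sylvester_eq_of_ne_zero {c : ℂ} (hc : c ≠ 0) (p : ℕ) (E : ℕ → ℕ → ℂ) :
    ∃ X : ℕ → ℕ → ℂ, (∀ b, X p b = 0) ∧ ∀ a b, a < p → sylvester c X a b = E a b := by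
  let row : (ℕ → ℂ) → (ℕ → ℂ) → ℕ → ℂ := fun e z b =>
    Nat.rec ((e 0 + z 0) / c) (fun b y => (e (b + 1) - y + z (b + 1)) / c) b
  let Z : ℕ → ℕ → ℂ := fun d => Nat.rec (fun _ => 0) (fun d z => row (E (p - 1 - d)) z) d
  refine ⟨fun a b => Z (p - a) b, fun b => by simp [Z], fun a b ha => ?_⟩
  obtain ⟨d, rfl⟩ := Nat.exists_eq_add_of_lt ha
  have h1 : a + d + 1 - a = d + 1 := by omega
  have h2 : a + d + 1 - (a + 1) = d := by omega
  have h3 : ∀ b, Z (d + 1) b = row (E a) (Z d) b := fun b => by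
    change row (E (a + d + 1 - 1 - d)) (Z d) b = _
    rw [show a + d + 1 - 1 - d = a by omega]
  simp only [sylvester, h1, h2, h3]
  cases b with
  | zero =>
    change c * ((E a 0 + Z d 0) / c) + 0 - Z d 0 = E a 0
    field_simp; ring
  | succ b =>
    simp only [row, Nat.add_sub_cancel, Nat.succ_ne_zero, if_false]
    field_simp; ring

/-- With `c = 0` the equation at `(a, b + 1)` gives `X a b` from the row below. The equations in
column `0` contain no such unknown and are left out. -/
theorem exists_sylvester_eq_of_ne_zero_column (p : ℕ) (E : ℕ → ℕ → ℂ) :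
    ∃ X : ℕ → ℕ → ℂ, (∀ b, X p b = 0) ∧
      ∀ a b, a < p → b ≠ 0 → sylvester 0 X a b = E a b := by
  let Z : ℕ → ℕ → ℂ := fun d =>
    Nat.rec (fun _ => 0) (fun d z b => E (p - 1 - d) (b + 1) + z (b + 1)) d
  refine ⟨fun a b => Z (p - a) b, fun b => by simp [Z], fun a b ha hb => ?_⟩
  obtain ⟨d, rfl⟩ := Nat.exists_eq_add_of_lt ha
  obtain ⟨b, rfl⟩ := Nat.exists_eq_succ_of_ne_zero hb
  have h1 : a + d + 1 - a = d + 1 := by omega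
  have h2 : a + d + 1 - (a + 1) = d := by omega
  have h3 : Z (d + 1) b = E a (b + 1) + Z d (b + 1) := by
    change E (a + d + 1 - 1 - d) (b + 1) + _ = _
    rw [show a + d + 1 - 1 - d = a by omega]
  simp [sylvester, h1, h2, h3]

theorem exists_sylvester_eq_of_ne_last_row (p : ℕ) (E : ℕ → ℕ → ℂ) :
    ∃ X : ℕ → ℕ → ℂ, (∀ b, X p b = 0) ∧ ∀ a b, a + 1 < p → sylvester 0 X a b = E a b := by
  let row : (ℕ → ℂ) → (ℕ → ℂ) → ℕ → ℂ := fun e z b =>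
    Nat.casesOn b (-e 0) (fun b => z b - e (b + 1))
  let Y : ℕ → ℕ → ℂ := fun a => Nat.rec (fun _ => 0) (fun a z => row (E a) z) a
  -- The rows `Y` are built downward from a zero row `0`. Cutting them off at row `p` is invisible
  -- to the equations with `a + 1 < p`.
  refine ⟨fun a b => if a < p then Y a b else 0, fun b => by simp, fun a b ha => ?_⟩
  have h1 : ∀ b, Y (a + 1) b = row (E a) (Y a) b := fun b => rfl
  simp only [sylvester, ha, (Nat.lt_succ_self a).trans ha, if_true, h1]
  cases b with
  | zero => simp [row]
  | succ b => simp [row]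

theorem exists_sylvester_eq (p q : ℕ) (c : ℂ) (E : ℕ → ℕ → ℂ) :
    ∃ X : ℕ → ℕ → ℂ, (∀ b, X p b = 0) ∧ ∀ (a : Fin p) (b : Fin q),
      ¬(c = 0 ∧ IsStarT p q a b) → sylvester c X a b = E a b := by
  by_cases hc : c = 0
  · subst hc
    by_cases hpq : p < q
    · obtain ⟨X, hX, h⟩ := exists_sylvester_eq_of_ne_zero_column p E
      exact ⟨X, hX, fun a b hs => h a b a.2 (by simpa [IsStarT, hpq] using hs)⟩
    · obtain ⟨X, hX, h⟩ := exists_sylvester_eq_of_ne_last_row p E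
      refine ⟨X, hX, fun a b hs => h a b ?_⟩
      have : (a : ℕ) + 1 ≠ p := by simpa [IsStarT, hpq] using hs
      omega
  · obtain ⟨X, hX, h⟩ := exists_sylvester_eq_of_ne_zero hc p E
    exact ⟨X, hX, fun a b _ => h a b a.2⟩

/-- An array `X J - J X` that vanishes outside the stars vanishes. -/
theorem sylvester_eq_zero_of_isStarT {p q : ℕ} {X : ℕ → ℕ → ℂ} (hX : ∀ b, X p b = 0)
    (h : ∀ (a : Fin p) (b : Fin q), ¬IsStarT p q a b → sylvester 0 X a b = 0)
    (a : Fin p) (b : Fin q) (hab : IsStarT p q a b) : sylvester 0 X a b = 0 := by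
  have h' : ∀ a b, a < p → b < q → ¬(if p < q then b = 0 else a + 1 = p) →
      (if b = 0 then 0 else X a (b - 1)) = X (a + 1) b := by
    intro a b ha hb hs
    have := h ⟨a, ha⟩ ⟨b, hb⟩ hs
    simpa [sylvester, sub_eq_zero] using this
  by_cases hpq : p < q
  · have hb : (b : ℕ) = 0 := by simpa [IsStarT, hpq] using hab
    -- Outside column `0` the equations make `X` constant along diagonals, so these entries slide
    -- down to the zero row `p`; `p < q` keeps the columns in range.
    have key : ∀ d a b, a + 1 + d = p → b ≤ a → X (a + 1) b = 0 := by
      intro d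
      induction d with
      | zero => rintro a b rfl _; exact hX b
      | succ d ih =>
        intro a b hd hba
        have := h' (a + 1) (b + 1) (by omega) (by omega) (by simp [hpq])
        simp only [Nat.succ_ne_zero, if_false, Nat.add_sub_cancel] at this
        rw [this]
        exact ih (a + 1) (b + 1) (by omega) (by omega)
    have := key (p - (a + 1)) a b (by omega) (by omega)
    simpa [sylvester, hb] using this
  · have ha : (a : ℕ) + 1 = p := by simpa [IsStarT, hpq] using hab
    -- Here entries slide up their diagonal and leave through the left border, because `b ≤ a`; the
    -- last row is never used as an equation.
    have key : ∀ b a, a < p → b < q → b ≤ a → (if b = 0 then 0 else X a (b - 1)) = 0 := by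
      intro b
      induction b with
      | zero => simp
      | succ b ih =>
        intro a hap hb hba
        obtain ⟨a, rfl⟩ : ∃ a', a = a' + 1 := ⟨a - 1, by omega⟩
        have h1 := h' a b (by omega) (by omega) (by simp [hpq]; omega)
        have h2 := ih a (by omega) (by omega) (by omega)
        simpa [h2] using h1.symm
    have := key b a a.2 b.2 (by omega)
    simp [sylvester, this, ha, hX]

end SylvesterRecursion

/-! ### Commutators with a direct sum of Jordan blocks -/

section JordanSum

theorem sum_mul_jordanBlock (r : ℕ) (μ : ℂ) (f : ℕ → ℂ) (b : Fin r) :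
    ∑ c : Fin r, f c * jordanBlock r μ c b =
      f b * μ + if (b : ℕ) = 0 then 0 else f (b - 1) := by
  have h : ∀ c : Fin r, f c * jordanBlock r μ c b =
      (if c = b then f c * μ else 0) + if (c : ℕ) + 1 = b then f c else 0 := by
    intro c
    by_cases hc : c = b
    · subst hc; simp [jordanBlock]
    · simp [jordanBlock, hc]
  simp only [h, Finset.sum_add_distrib, Finset.sum_ite_eq', Finset.mem_univ, if_true]
  congr 1
  split_ifs with hb
  · exact Finset.sum_eq_zero fun c _ => if_neg (by omega)
  · rw [Finset.sum_eq_single ⟨b - 1, by omega⟩]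
    · simp [Nat.sub_add_cancel (Nat.one_le_iff_ne_zero.2 hb)]
    · intro c _ hc
      refine if_neg fun h => hc (Fin.ext ?_)
      simp; omega
    · simp

/-- The condition `hf` makes the shift formula correct in the last row, where the Jordan block has
no superdiagonal unit. -/
theorem sum_jordanBlock_mul (r : ℕ) (μ : ℂ) (f : ℕ → ℂ) (hf : f r = 0) (a : Fin r) :
    ∑ c : Fin r, jordanBlock r μ a c * f c = μ * f a + f (a + 1) := by
  have h : ∀ c : Fin r, jordanBlock r μ a c * f c =
      (if a = c then μ * f c else 0) + if (a : ℕ) + 1 = c then f c else 0 := by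
    intro c
    by_cases hc : a = c
    · subst hc; simp [jordanBlock]
    · simp [jordanBlock, hc]
  simp only [h, Finset.sum_add_distrib, Finset.sum_ite_eq, Finset.mem_univ, if_true]
  congr 1
  by_cases ha : (a : ℕ) + 1 = r
  · rw [ha, hf]
    exact Finset.sum_eq_zero fun c _ => if_neg (by omega)
  · rw [Finset.sum_eq_single ⟨a + 1, by omega⟩]
    · simp
    · intro c _ hc
      refine if_neg fun h => hc (Fin.ext ?_)
      simp; omega
    · simp

variable {K : Type*} [Fintype K] [DecidableEq K] (r : K → ℕ) (μ : K → ℂ)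

/-- The direct sum of the Jordan blocks `J_{r k}(μ k)`. -/
def jordanSum : Matrix (Σ k, Fin (r k)) (Σ k, Fin (r k)) ℂ :=
  Matrix.blockDiagonal' fun k => jordanBlock (r k) (μ k)

/-- The positions of the parameters in Arnold's miniversal deformation of a direct sum of Jordan
blocks. -/
def IsArnoldStar (x y : Σ k, Fin (r k)) : Prop :=
  μ x.1 = μ y.1 ∧ IsStarT (r x.1) (r y.1) x.2 y.2

variable {r μ}

theorem mul_jordanSum_apply (X : Matrix (Σ k, Fin (r k)) (Σ k, Fin (r k)) ℂ)
    (x : Σ k, Fin (r k)) (k : K) (b : Fin (r k)) :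
    (X * jordanSum r μ) x ⟨k, b⟩ = ∑ c, X x ⟨k, c⟩ * jordanBlock (r k) (μ k) c b := by
  rw [Matrix.mul_apply, Fintype.sum_sigma, Finset.sum_eq_single k]
  · simp [jordanSum]
  · intro k' _ hk
    refine Finset.sum_eq_zero fun c _ => ?_
    rw [jordanSum, Matrix.blockDiagonal'_apply_ne _ _ _ hk, mul_zero]
  · simp

theorem jordanSum_mul_apply (X : Matrix (Σ k, Fin (r k)) (Σ k, Fin (r k)) ℂ)
    (k : K) (a : Fin (r k)) (y : Σ k, Fin (r k)) :
    (jordanSum r μ * X) ⟨k, a⟩ y = ∑ c, jordanBlock (r k) (μ k) a c * X ⟨k, c⟩ y := by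
  rw [Matrix.mul_apply, Fintype.sum_sigma, Finset.sum_eq_single k]
  · simp [jordanSum]
  · intro k' _ hk
    refine Finset.sum_eq_zero fun c _ => ?_
    rw [jordanSum, Matrix.blockDiagonal'_apply_ne _ _ _ hk.symm, zero_mul]
  · simp

theorem commutator_jordanSum_apply (X : Matrix (Σ k, Fin (r k)) (Σ k, Fin (r k)) ℂ)
    (Y : K → K → ℕ → ℕ → ℂ) (hXY : ∀ x y, X x y = Y x.1 y.1 x.2 y.2)
    (hY : ∀ k k' b, Y k k' (r k) b = 0) (x y : Σ k, Fin (r k)) :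
    (X * jordanSum r μ - jordanSum r μ * X) x y =
      sylvester (μ y.1 - μ x.1) (Y x.1 y.1) x.2 y.2 := by
  obtain ⟨k, a⟩ := x
  obtain ⟨k', b⟩ := y
  rw [Matrix.sub_apply, mul_jordanSum_apply, jordanSum_mul_apply]
  simp only [hXY]
  rw [sum_mul_jordanBlock (f := Y k k' a),
    sum_jordanBlock_mul (f := fun a => Y k k' a b) (hf := hY k k' b), sylvester]
  ring

theorem exists_commutator_jordanSum (E : Matrix (Σ k, Fin (r k)) (Σ k, Fin (r k)) ℂ) :
    ∃ X : Matrix (Σ k, Fin (r k)) (Σ k, Fin (r k)) ℂ, ∀ x y, ¬IsArnoldStar r μ x y →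
      (X * jordanSum r μ - jordanSum r μ * X) x y = E x y := by
  choose Y hY h using fun k k' => exists_sylvester_eq (r k) (r k') (μ k' - μ k) fun a b =>
    if h : a < r k ∧ b < r k' then E ⟨k, ⟨a, h.1⟩⟩ ⟨k', ⟨b, h.2⟩⟩ else 0
  refine ⟨Matrix.of fun x y => Y x.1 y.1 x.2 y.2, fun x y hxy => ?_⟩
  refine (commutator_jordanSum_apply _ Y (fun _ _ => rfl) hY x y).trans ?_
  rw [h]
  · simp
  · rintro ⟨h1, h2⟩
    exact hxy ⟨(sub_eq_zero.1 h1).symm, h2⟩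

theorem commutator_jordanSum_eq_zero (X : Matrix (Σ k, Fin (r k)) (Σ k, Fin (r k)) ℂ)
    (h : ∀ x y, ¬IsArnoldStar r μ x y → (X * jordanSum r μ - jordanSum r μ * X) x y = 0)
    (x y : Σ k, Fin (r k)) (hxy : IsArnoldStar r μ x y) :
    (X * jordanSum r μ - jordanSum r μ * X) x y = 0 := by
  let Y : K → K → ℕ → ℕ → ℂ := fun k k' a b =>
    if h : a < r k ∧ b < r k' then X ⟨k, ⟨a, h.1⟩⟩ ⟨k', ⟨b, h.2⟩⟩ else 0
  have hXY : ∀ x y, X x y = Y x.1 y.1 x.2 y.2 := fun x y => by simp [Y]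
  have hY : ∀ k k' b, Y k k' (r k) b = 0 := fun k k' b => by simp [Y]
  simp only [commutator_jordanSum_apply X Y hXY hY] at h ⊢
  obtain ⟨k, a⟩ := x
  obtain ⟨k', b⟩ := y
  have hμ : μ k' - μ k = 0 := by rw [hxy.1, sub_self]
  rw [hμ]
  refine sylvester_eq_zero_of_isStarT (hY k k') (fun a b hab => ?_) a b hxy.2
  have := h ⟨k, a⟩ ⟨k', b⟩ fun hs => hab hs.2
  simpa only [hμ] using this

end JordanSum

/-! ### Arnold's miniversal deformation up to permutation -/

section Arnold

variable {m ι : Type*} [Fintype m] [DecidableEq m] [Fintype ι]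
variable {K : Type*} [Fintype K] [DecidableEq K] {r : K → ℕ} {μ : K → ℂ}

/-- Arnold's theorem: the deformation of a Jordan matrix (with rows and columns permuted
simultaneously in an arbitrary way) with the stars as independent parameters is miniversal. -/
theorem isMiniversal_of_isSimpleAt_arnoldStars (e : m ≃ Σ k, Fin (r k))
    {D : (ι → ℂ) → Matrix m m ℂ} {pos : ι ↪ m × m}
    (hD : IsSimpleAt ((jordanSum r μ).submatrix e e) D pos)
    (hpos : ∀ p q, (p, q) ∈ Set.range pos ↔ IsArnoldStar r μ (e p) (e q)) :
    IsMiniversal ((jordanSum r μ).submatrix e e) D := by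
  classical
  set A := (jordanSum r μ).submatrix e e with hA
  let B : (ι → ℂ) →ₗ[ℂ] Matrix m m ℂ :=
    { toFun := fun α => D α - A
      map_add' := fun α β => by
        ext p q
        rw [Matrix.add_apply]
        by_cases h : (p, q) ∈ Set.range pos
        · obtain ⟨t, ht⟩ := h
          have h1 := (hD α).1 t
          have h2 := (hD β).1 t
          have h3 := (hD (α + β)).1 t
          rw [ht] at h1 h2 h3
          rw [h1, h2, h3, Pi.add_apply]
        · rw [(hD _).2 p q h, (hD _).2 p q h, (hD _).2 p q h, add_zero]
      map_smul' := fun c α => by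
        ext p q
        rw [Matrix.smul_apply]
        by_cases h : (p, q) ∈ Set.range pos
        · obtain ⟨t, ht⟩ := h
          have h1 := (hD α).1 t
          have h3 := (hD (c • α)).1 t
          rw [ht] at h1 h3
          rw [h1, h3, Pi.smul_apply, RingHom.id_apply]
        · rw [(hD _).2 p q h, (hD _).2 p q h, smul_zero] }
  have hB : ∀ α, B α = D α - A := fun _ => rfl
  have hDB : D = fun α => A + B α := by
    funext α
    rw [hB, add_sub_cancel]
  -- Reindexing commutes with products, so commutators with `A` are permuted commutators with the
  -- Jordan matrix.
  have hcomm : ∀ X : Matrix m m ℂ, X * A - A * X =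
      (X.submatrix e.symm e.symm * jordanSum r μ -
        jordanSum r μ * X.submatrix e.symm e.symm).submatrix e e := by
    intro X
    rw [Matrix.submatrix_sub, Pi.sub_apply, Pi.sub_apply, ← Matrix.submatrix_mul_equiv _ _ _ e,
      ← Matrix.submatrix_mul_equiv _ _ _ e]
    simp [hA]
  rw [hDB]
  refine isMiniversal_of_complement A B (fun E => ?_) (fun X α hX => ?_)
  · obtain ⟨X, hX⟩ := exists_commutator_jordanSum (μ := μ) (E.submatrix e.symm e.symm)
    let Y := X.submatrix e e
    -- `Y` settles all entries outside the stars; the parameters are the remaining discrepancies at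
    -- the stars.
    refine ⟨Y, fun t => (E - (Y * A - A * Y)) (pos t).1 (pos t).2, ?_⟩
    ext p q
    rw [Matrix.add_apply, hB]
    by_cases h : (p, q) ∈ Set.range pos
    · obtain ⟨t, ht⟩ := h
      have := (hD fun t => (E - (Y * A - A * Y)) (pos t).1 (pos t).2).1 t
      simp only [ht] at this
      rw [this, ← Matrix.add_apply, add_sub_cancel]
    · rw [(hD _).2 p q h, add_zero, hcomm]
      have := hX (e p) (e q) fun hs => h ((hpos p q).2 hs)
      simpa [Y] using this
  · rw [hcomm] at hX
    funext t
    have h1 := commutator_jordanSum_eq_zero (μ := μ) (X.submatrix e.symm e.symm) (fun x y hxy => ?_)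
      (e (pos t).1) (e (pos t).2) ((hpos _ _).1 ⟨t, rfl⟩)
    · have h2 := congrFun (congrFun hX (pos t).1) (pos t).2
      rw [Matrix.submatrix_apply, h1, hB, (hD α).1 t] at h2
      exact h2.symm
    · have h2 := congrFun (congrFun hX (e.symm x)) (e.symm y)
      rw [Matrix.submatrix_apply, e.apply_symm_apply, e.apply_symm_apply] at h2
      rw [h2, hB, (hD α).2]
      rw [hpos]
      simpa using hxy

end Arnold

/-! ### Strips of the Weyr form and the next-column shift -/

section Strips

variable {K : Type*} {r : K → ℕ}

/-- The invariant of a position in a direct sum of Jordan blocks that determines its strip in the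
Weyr form: the group of its eigenvalue, its column in the Jordan block, and the size of the block,
ordered as the strips. -/
def weyrKey (g : K → ℕ) (x : Σ k, Fin (r k)) : ℕ ×ₗ (ℕ ×ₗ ℕᵒᵈ) :=
  toLex (g x.1, toLex ((x.2 : ℕ), OrderDual.toDual (r x.1)))

theorem weyrKey_eq_iff {g : K → ℕ} {x y : Σ k, Fin (r k)} :
    weyrKey g x = weyrKey g y ↔
      g x.1 = g y.1 ∧ (x.2 : ℕ) = y.2 ∧ r x.1 = r y.1 := by
  simp [weyrKey, Prod.ext_iff]

theorem weyrKey_le_iff {g : K → ℕ} {x y : Σ k, Fin (r k)} :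
    weyrKey g x ≤ weyrKey g y ↔
      g x.1 < g y.1 ∨ g x.1 = g y.1 ∧ ((x.2 : ℕ) < y.2 ∨ (x.2 : ℕ) = y.2 ∧ r y.1 ≤ r x.1) := by
  simp [weyrKey, Prod.Lex.toLex_le_toLex]

/-- The position in the Weyr order. -/
def weyrPosition (g i : K → ℕ) (x : Σ k, Fin (r k)) : ℕ ×ₗ (ℕ ×ₗ ℕ) :=
  toLex (g x.1, toLex ((x.2 : ℕ), i x.1))

theorem weyrPosition_lt_iff {g i : K → ℕ} {x y : Σ k, Fin (r k)} :
    weyrPosition g i x < weyrPosition g i y ↔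
      g x.1 < g y.1 ∨ g x.1 = g y.1 ∧ ((x.2 : ℕ) < y.2 ∨ (x.2 : ℕ) = y.2 ∧ i x.1 < i y.1) := by
  simp [weyrPosition, Prod.Lex.toLex_lt_toLex]

variable {m : Type*} [Fintype m] (e : m ≃ Σ k, Fin (r k))

/-- The numbering of the strips of a Weyr form. -/
def weyrStrip (g : K → ℕ) (p : m) : ℕ :=
  ((Finset.univ.image fun q => weyrKey g (e q)).filter (· < weyrKey g (e p))).card

variable {e}

/-- Among the smaller keys being counted, that of `p` contributes to `q` but not to `p`. -/
theorem weyrStrip_lt_of_weyrKey_lt {g : K → ℕ} {p q : m}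
    (h : weyrKey g (e p) < weyrKey g (e q)) : weyrStrip e g p < weyrStrip e g q := by
  refine Finset.card_lt_card (Finset.ssubset_iff_of_subset ?_ |>.2 ⟨weyrKey g (e p), ?_, ?_⟩)
  · exact Finset.monotone_filter_right _ fun _ _ hk => lt_trans hk h
  · simp [h]
  · simp

theorem weyrStrip_le_iff {g : K → ℕ} {p q : m} :
    weyrStrip e g p ≤ weyrStrip e g q ↔ weyrKey g (e p) ≤ weyrKey g (e q) := by
  refine ⟨fun h => not_lt.1 fun h' => (weyrStrip_lt_of_weyrKey_lt h').not_ge h, fun h => ?_⟩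
  exact Finset.card_le_card (Finset.monotone_filter_right _ fun _ _ hk => lt_of_lt_of_le hk h)

theorem weyrStrip_eq_iff {g : K → ℕ} {p q : m} :
    weyrStrip e g p = weyrStrip e g q ↔ weyrKey g (e p) = weyrKey g (e q) := by
  simp only [le_antisymm_iff, weyrStrip_le_iff]

/-- `y` comes from the column next to that of `x` in the same Jordan block. -/
def IsNextColumn (x y : Σ k, Fin (r k)) : Prop :=
  x.1 = y.1 ∧ (x.2 : ℕ) + 1 = y.2

theorem IsNextColumn.ne {x y : Σ k, Fin (r k)} (h : IsNextColumn x y) : x ≠ y := by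
  rintro rfl
  exact absurd h.2 (by omega)

theorem IsNextColumn.right_unique {x y z : Σ k, Fin (r k)} (h : IsNextColumn x y)
    (h' : IsNextColumn x z) : y = z := by
  obtain ⟨k, a⟩ := x
  obtain ⟨k', b⟩ := y
  obtain ⟨k'', c⟩ := z
  obtain ⟨rfl, h⟩ := h
  obtain ⟨rfl, h'⟩ := h'
  simp only at h h'
  rw [Fin.ext (h.symm.trans h')]

theorem exists_isNextColumn {x : Σ k, Fin (r k)} (h : (x.2 : ℕ) + 1 < r x.1) :
    ∃ y, IsNextColumn x y :=
  ⟨⟨x.1, ⟨x.2 + 1, h⟩⟩, rfl, rfl⟩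

theorem exists_isNextColumn_left {y : Σ k, Fin (r k)} (h : (y.2 : ℕ) ≠ 0) :
    ∃ x, IsNextColumn x y :=
  ⟨⟨y.1, ⟨y.2 - 1, by omega⟩⟩, rfl, Nat.sub_add_cancel (Nat.one_le_iff_ne_zero.2 h)⟩

/-- The shift keeps the group and the block size and adds one to the column, so it respects strips
in both directions. -/
theorem IsNextColumn.weyrKey_eq_weyrKey_iff {g : K → ℕ} {x y x' y' : Σ k, Fin (r k)}
    (h : IsNextColumn x y) (h' : IsNextColumn x' y') :
    weyrKey g x = weyrKey g x' ↔ weyrKey g y = weyrKey g y' := by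
  rw [weyrKey_eq_iff, weyrKey_eq_iff, ← h.2, ← h'.2, ← h.1, ← h'.1, Nat.add_left_inj]

theorem IsNextColumn.weyrPosition_lt_weyrPosition_iff {g i : K → ℕ}
    {x y x' y' : Σ k, Fin (r k)} (h : IsNextColumn x y) (h' : IsNextColumn x' y') :
    weyrPosition g i x < weyrPosition g i x' ↔ weyrPosition g i y < weyrPosition g i y' := by
  rw [weyrPosition_lt_iff, weyrPosition_lt_iff, ← h.2, ← h'.2, ← h.1, ← h'.1, Nat.add_left_inj,
    Nat.add_lt_add_iff_right]

variable [DecidableEq K] {μ : K → ℂ}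

theorem jordanSum_apply_self (x : Σ k, Fin (r k)) : jordanSum r μ x x = μ x.1 := by
  simp [jordanSum, jordanBlock, Matrix.blockDiagonal'_apply]

theorem jordanSum_apply_of_isNextColumn {x y : Σ k, Fin (r k)} (h : IsNextColumn x y) :
    jordanSum r μ x y = 1 := by
  obtain ⟨k, a⟩ := x
  obtain ⟨k', b⟩ := y
  obtain ⟨rfl, h⟩ := h
  simp only at h
  have hab : a ≠ b := by rintro rfl; omega
  simp [jordanSum, jordanBlock, h, hab]

theorem jordanSum_apply_eq_zero {x y : Σ k, Fin (r k)} (hxy : x ≠ y) (h : ¬IsNextColumn x y) :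
    jordanSum r μ x y = 0 := by
  obtain ⟨k, a⟩ := x
  obtain ⟨k', b⟩ := y
  by_cases hk : k = k'
  · subst hk
    have hab : a ≠ b := by rintro rfl; exact hxy rfl
    have hab' : (a : ℕ) + 1 ≠ b := fun h' => h ⟨rfl, h'⟩
    simp [jordanSum, jordanBlock, hab, hab']
  · exact Matrix.blockDiagonal'_apply_ne _ _ _ hk

end Strips

/-! ### The coarsest partition and block triangularity -/

section Coarsest

variable {K : Type*} [DecidableEq K] {r : K → ℕ} {μ : K → ℂ} {g i : K → ℕ}
variable {m : Type*} [LinearOrder m] {e : m ≃ Σ k, Fin (r k)}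

-- Within one group and column, a later block is no larger by `hr`, and the key reverses the order
-- of sizes.
omit [DecidableEq K] in
theorem monotone_weyrStrip [Fintype m] (hr : ∀ k k', g k = g k' → i k ≤ i k' → r k' ≤ r k)
    (hmono : StrictMono fun p => weyrPosition g i (e p)) : Monotone (weyrStrip e g) := by
  intro p q hpq
  rw [weyrStrip_le_iff]
  obtain rfl | hlt := hpq.eq_or_lt
  · exact le_rfl
  · rw [weyrKey_le_iff]
    have h := weyrPosition_lt_iff.1 (hmono hlt)
    refine h.imp_right fun h => ⟨h.1, h.2.imp_right fun h' => ⟨h'.1, hr _ _ h.1 h'.2.le⟩⟩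

theorem isScalarIdentityPartition_weyrStrip [Fintype m] (hg : ∀ k k', μ k = μ k' ↔ g k = g k')
    (hr : ∀ k k', g k = g k' → i k ≤ i k' → r k' ≤ r k)
    (hmono : StrictMono fun p => weyrPosition g i (e p)) :
    IsScalarIdentityPartition ((jordanSum r μ).submatrix e e) (weyrStrip e g) := by
  refine ⟨monotone_weyrStrip hr hmono, fun u => ?_, fun u v huv => ?_⟩
  · by_cases hu : ∃ p₀, weyrStrip e g p₀ = u
    · obtain ⟨p₀, rfl⟩ := hu
      refine ⟨μ (e p₀).1, fun p q hp hq => ?_⟩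
      rw [weyrStrip_eq_iff, weyrKey_eq_iff] at hp hq
      rw [Matrix.submatrix_apply]
      split_ifs with hpq
      · subst hpq
        rw [jordanSum_apply_self]
        exact (hg _ _).2 hp.1
      · refine jordanSum_apply_eq_zero (fun h => hpq (e.injective h)) fun h => ?_
        have := h.2
        omega
    · exact ⟨0, fun p q hp _ => absurd ⟨p, hp⟩ hu⟩
  -- A single pair of consecutive columns forces the shift to be an order isomorphism between the
  -- whole strips, hence an identity block.
  · by_cases h : ∃ p q, weyrStrip e g p = u ∧ weyrStrip e g q = v ∧ IsNextColumn (e p) (e q)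
    · right
      obtain ⟨p₀, q₀, hp₀, hq₀, h₀⟩ := h
      have hnext : ∀ p : {p // weyrStrip e g p = u}, ∃ q : {q // weyrStrip e g q = v},
          IsNextColumn (e p) (e q) := by
        rintro ⟨p, hp⟩
        have hk := weyrStrip_eq_iff.1 (hp.trans hp₀.symm)
        have hk' := weyrKey_eq_iff.1 hk
        have hlt : ((e p).2 : ℕ) + 1 < r (e p).1 := by
          rw [hk'.2.1, hk'.2.2, h₀.2, h₀.1]
          exact (e q₀).2.2
        obtain ⟨y, hy⟩ := exists_isNextColumn hlt
        obtain ⟨q, rfl⟩ := e.surjective y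
        refine ⟨⟨q, ?_⟩, hy⟩
        rw [← hq₀, weyrStrip_eq_iff]
        exact (hy.weyrKey_eq_weyrKey_iff h₀).1 hk
      choose f hf using hnext
      have hfmono : StrictMono f := fun p q hpq => by
        rw [← Subtype.coe_lt_coe, ← hmono.lt_iff_lt] at hpq ⊢
        exact ((hf p).weyrPosition_lt_weyrPosition_iff (hf q)).1 hpq
      have hfsurj : Function.Surjective f := by
        rintro ⟨q, hq⟩
        have hk := weyrStrip_eq_iff.1 (hq.trans hq₀.symm)
        have hk' := weyrKey_eq_iff.1 hk
        obtain ⟨x, hx⟩ := exists_isNextColumn_left (y := e q) (by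
          rw [hk'.2.1, ← h₀.2]; omega)
        obtain ⟨p, rfl⟩ := e.surjective x
        refine ⟨⟨p, ?_⟩, ?_⟩
        · rw [← hp₀, weyrStrip_eq_iff]
          exact (hx.weyrKey_eq_weyrKey_iff h₀).2 hk
        · exact Subtype.ext (e.injective ((hf _).right_unique hx))
      refine ⟨hfmono.orderIsoOfSurjective f hfsurj, fun p q => ?_⟩
      rw [Matrix.submatrix_apply, StrictMono.coe_orderIsoOfSurjective]
      split_ifs with hpq
      · subst hpq
        exact jordanSum_apply_of_isNextColumn (hf p)
      · refine jordanSum_apply_eq_zero (fun h => huv ?_) fun h => hpq ?_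
        · rw [← p.2, ← q.2, e.injective h]
        · exact Subtype.ext (e.injective ((hf p).right_unique h))
    · left
      intro p q hp hq
      refine jordanSum_apply_eq_zero (fun h' => huv ?_) fun h' => h ⟨p, q, hp, hq, h'⟩
      rw [← hp, ← hq, e.injective h']

section Refine

variable {b : m → ℕ} (hb : IsScalarIdentityPartition ((jordanSum r μ).submatrix e e) b)

include hb

theorem IsScalarIdentityPartition.eigenvalue_eq {p q : m} (hpq : b p = b q) :
    μ (e p).1 = μ (e q).1 := by
  obtain ⟨c, hc⟩ := hb.2.1 (b p)
  have hp := hc p p rfl rfl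
  have hq := hc q q hpq.symm hpq.symm
  rw [if_pos rfl, Matrix.submatrix_apply, jordanSum_apply_self] at hp hq
  rw [hp, hq]

theorem IsScalarIdentityPartition.strip_ne {p q : m} (h : IsNextColumn (e p) (e q)) :
    b p ≠ b q := by
  intro hpq
  obtain ⟨c, hc⟩ := hb.2.1 (b p)
  have := hc p q rfl hpq.symm
  rw [if_neg (fun h' => h.ne (congrArg e h')), Matrix.submatrix_apply,
    jordanSum_apply_of_isNextColumn h] at this
  exact one_ne_zero this

/-- The unit at `(p, q)` rules out a zero block. In an off-diagonal identity block every unit is a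
superdiagonal unit of a Jordan block, so the block realizes the shift. -/
theorem IsScalarIdentityPartition.exists_orderIso {p q : m} (h : IsNextColumn (e p) (e q)) :
    ∃ f : {p' // b p' = b p} ≃o {q' // b q' = b q},
      ∀ p' : {p' // b p' = b p}, IsNextColumn (e p') (e (f p')) := by
  have hne := hb.strip_ne h
  obtain h0 | ⟨f, hf⟩ := hb.2.2 _ _ hne
  · have := h0 p q rfl rfl
    rw [Matrix.submatrix_apply, jordanSum_apply_of_isNextColumn h] at this
    exact absurd this one_ne_zero
  · refine ⟨f, fun p' => ?_⟩
    by_contra hcon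
    have := hf p' (f p')
    rw [if_pos rfl, Matrix.submatrix_apply, jordanSum_apply_eq_zero (fun h' => hne ?_) hcon] at this
    · exact zero_ne_one this
    · rw [← p'.2, ← (f p').2, e.injective h']

/-- Each step of `p` to the left is an identity block, which takes the whole strip along; thus `q`
can make as many steps. -/
theorem IsScalarIdentityPartition.column_le (d : ℕ) : ∀ p q : m, b p = b q →
    ((e p).2 : ℕ) = d → d ≤ (e q).2 := by
  induction d with
  | zero => exact fun _ _ _ _ => Nat.zero_le _
  | succ d ih =>
    intro p q hpq hp
    obtain ⟨x, hx⟩ := exists_isNextColumn_left (y := e p) (by omega)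
    obtain ⟨p₀, rfl⟩ := e.surjective x
    obtain ⟨f, hf⟩ := hb.exists_orderIso hx
    have h1 := hf (f.symm ⟨q, hpq.symm⟩)
    rw [OrderIso.apply_symm_apply] at h1
    have h2 := ih p₀ _ (f.symm ⟨q, hpq.symm⟩).2.symm (by have := hx.2; omega)
    have : ((e (f.symm ⟨q, hpq.symm⟩)).2 : ℕ) + 1 = (e q).2 := h1.2
    omega

/-- The same argument to the right, with `d` the number of columns remaining after `p`. -/
theorem IsScalarIdentityPartition.height_le (d : ℕ) : ∀ p q : m, b p = b q →
    ((e p).2 : ℕ) + 1 + d = r (e p).1 → ((e q).2 : ℕ) + 1 + d ≤ r (e q).1 := by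
  induction d with
  | zero => exact fun _ q _ _ => (e q).2.2
  | succ d ih =>
    intro p q hpq hp
    obtain ⟨y, hy⟩ := exists_isNextColumn (x := e p) (by omega)
    obtain ⟨p₁, rfl⟩ := e.surjective y
    obtain ⟨f, hf⟩ := hb.exists_orderIso hy
    have h1 := hf ⟨q, hpq.symm⟩
    have h2 := ih p₁ _ (f ⟨q, hpq.symm⟩).2.symm (by rw [← hy.2, ← hy.1]; omega)
    rw [← h1.2, ← h1.1] at h2
    simp only at h2
    omega

theorem IsScalarIdentityPartition.weyrKey_eq (hg : ∀ k k', μ k = μ k' → g k = g k') {p q : m}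
    (hpq : b p = b q) : weyrKey g (e p) = weyrKey g (e q) := by
  have h1 := hb.column_le _ p q hpq rfl
  have h2 := hb.column_le _ q p hpq.symm rfl
  have h3 := hb.height_le (r (e p).1 - ((e p).2 + 1)) p q hpq
    (Nat.add_sub_cancel' (e p).2.2)
  have h4 := hb.height_le (r (e q).1 - ((e q).2 + 1)) q p hpq.symm
    (Nat.add_sub_cancel' (e q).2.2)
  have h5 := (e p).2.2
  have h6 := (e q).2.2
  refine weyrKey_eq_iff.2 ⟨hg _ _ (hb.eigenvalue_eq hpq), by omega, by omega⟩

end Refine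

variable [Fintype m]

theorem isCoarsestPartition_weyrStrip (hg : ∀ k k', μ k = μ k' ↔ g k = g k')
    (hr : ∀ k k', g k = g k' → i k ≤ i k' → r k' ≤ r k)
    (hmono : StrictMono fun p => weyrPosition g i (e p)) :
    IsCoarsestPartition ((jordanSum r μ).submatrix e e) (weyrStrip e g) :=
  ⟨isScalarIdentityPartition_weyrStrip hg hr hmono, fun _ hb _ _ hpq =>
    weyrStrip_eq_iff.2 (hb.weyrKey_eq (fun k k' => (hg k k').1) hpq)⟩

-- A star in a first column has column `0` and a strictly larger block on the column side. A star in
-- a last row has row number at least its column number, with equality only for equal sizes.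
omit [DecidableEq K] [LinearOrder m] [Fintype m] in
theorem IsArnoldStar.weyrKey_le (hg : ∀ k k', μ k = μ k' → g k = g k') {x y : Σ k, Fin (r k)}
    (h : IsArnoldStar r μ x y) : weyrKey g y ≤ weyrKey g x := by
  obtain ⟨h1, h2⟩ := h
  refine weyrKey_le_iff.2 (Or.inr ⟨(hg _ _ h1).symm, ?_⟩)
  have := x.2.2
  have := y.2.2
  unfold IsStarT at h2
  split_ifs at h2 <;> omega

-- Being a star depends only on the keys of its row and column, so each block is all stars or has
-- none.
omit [LinearOrder m] in
theorem isSimpleLowerBlockTriangular_weyrStrip {ι : Type*}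
    (hg : ∀ k k', μ k = μ k' ↔ g k = g k') {D : (ι → ℂ) → Matrix m m ℂ} {pos : ι ↪ m × m}
    (hD : IsSimpleAt ((jordanSum r μ).submatrix e e) D pos)
    (hpos : ∀ p q, (p, q) ∈ Set.range pos ↔ IsArnoldStar r μ (e p) (e q)) :
    IsSimpleLowerBlockTriangular (weyrStrip e g) ((jordanSum r μ).submatrix e e) D := by
  refine ⟨pos, hD, fun α p q hpq => (hD α).2 p q fun hs => ?_, fun u v => ?_⟩
  · exact hpq.not_ge (weyrStrip_le_iff.2
      (((hpos p q).1 hs).weyrKey_le fun k k' => (hg k k').1))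
  · by_cases h : ∃ p q, weyrStrip e g p = u ∧ weyrStrip e g q = v ∧ (p, q) ∈ Set.range pos
    · right
      obtain ⟨p₀, q₀, rfl, rfl, h⟩ := h
      intro p q hp hq
      rw [weyrStrip_eq_iff, weyrKey_eq_iff] at hp hq
      rw [hpos] at h ⊢
      refine ⟨?_, ?_⟩
      · rw [(hg _ _).2 hp.1, (hg _ _).2 hq.1]
        exact h.1
      · have h2 := h.2
        unfold IsStarT at h2 ⊢
        rw [hp.2.1, hp.2.2, hq.2.1, hq.2.2]
        exact h2
    · left
      exact fun p q hp hq hs => h ⟨p, q, hp, hq, hs⟩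

end Coarsest

/-! ### One eigenvalue -/

section SingleEigenvalue

variable {l : ℕ} (n : Fin l → ℕ) (lam : ℂ)

theorem weyrMatrix_eq_submatrix :
    weyrMatrix n lam =
      (jordanSum n fun _ => lam).submatrix (weyrPerm n).symm (weyrPerm n).symm := rfl

/-- The positions of the stars in `H^#`. -/
def weyrStarPos : Stars n ↪ WeyrIdx n × WeyrIdx n :=
  (Function.Embedding.subtype _).trans ((weyrPerm n).prodCongr (weyrPerm n)).toEmbedding

theorem mem_range_weyrStarPos (p q : WeyrIdx n) :
    (p, q) ∈ Set.range (weyrStarPos n) ↔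
      IsArnoldStar n (fun _ => lam) ((weyrPerm n).symm p) ((weyrPerm n).symm q) := by
  constructor
  · rintro ⟨t, ht⟩
    obtain ⟨rfl, rfl⟩ := Prod.ext_iff.1 ht
    exact ⟨rfl, t.2⟩
  · intro h
    exact ⟨⟨((weyrPerm n).symm p, (weyrPerm n).symm q), h.2⟩, by simp [weyrStarPos]⟩

theorem weyrArnoldMatrix_weyrStarPos (α : Stars n → ℂ) (t : Stars n) :
    weyrArnoldMatrix n α (weyrStarPos n t).1 (weyrStarPos n t).2 = α t := by
  obtain ⟨⟨x, y⟩, ht⟩ := t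
  change arnoldMatrix n α x y = _
  simp only [arnoldMatrix, Matrix.of_apply]
  exact dif_pos ht

theorem weyrArnoldMatrix_eq_zero (α : Stars n → ℂ) {p q : WeyrIdx n}
    (h : (p, q) ∉ Set.range (weyrStarPos n)) : weyrArnoldMatrix n α p q = 0 := by
  change arnoldMatrix n α ((weyrPerm n).symm p) ((weyrPerm n).symm q) = _
  simp only [arnoldMatrix, Matrix.of_apply]
  -- The stars do not depend on the eigenvalue; `0` is a dummy value.
  exact dif_neg fun hs => h ((mem_range_weyrStarPos n 0 p q).2 ⟨rfl, hs⟩)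

theorem isSimpleAt_weyrMatrix_add :
    IsSimpleAt (weyrMatrix n lam) (fun α => weyrMatrix n lam + weyrArnoldMatrix n α)
      (weyrStarPos n) := by
  intro α
  simp only [add_sub_cancel_left]
  exact ⟨weyrArnoldMatrix_weyrStarPos n α, fun p q h => weyrArnoldMatrix_eq_zero n α h⟩

theorem strictMono_weyrPosition :
    StrictMono fun p : WeyrIdx n =>
      weyrPosition (fun _ => 0) (fun i : Fin l => (i : ℕ)) ((weyrPerm n).symm p) := by
  intro p q hpq
  refine weyrPosition_lt_iff.2 (Or.inr ⟨rfl, ?_⟩)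
  rcases hpq with ⟨_, _, h⟩ | ⟨_, _, h⟩
  · exact Or.inl h
  · exact Or.inr ⟨rfl, h⟩

end SingleEigenvalue

/-! ### Several eigenvalues -/

section SeveralEigenvalues

variable {τ : ℕ} {l : Fin τ → ℕ} (n : ∀ a, Fin (l a) → ℕ) (lam : Fin τ → ℂ)

variable {n} in
theorem weyrDirectSum_apply_eq (M : ∀ a, Matrix (WeyrIdx (n a)) (WeyrIdx (n a)) ℂ) (a : Fin τ)
    (x y : WeyrIdx (n a)) : weyrDirectSum n M (toLex ⟨a, x⟩) (toLex ⟨a, y⟩) = M a x y :=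
  Matrix.blockDiagonal'_apply_eq M a x y

variable {n} in
theorem weyrDirectSum_apply_ne (M : ∀ a, Matrix (WeyrIdx (n a)) (WeyrIdx (n a)) ℂ) {a a' : Fin τ}
    (h : a ≠ a') (x : WeyrIdx (n a)) (y : WeyrIdx (n a')) :
    weyrDirectSum n M (toLex ⟨a, x⟩) (toLex ⟨a', y⟩) = 0 :=
  Matrix.blockDiagonal'_apply_ne M x y h

/-- The permutation of rows and columns that transforms the Weyr form to a Jordan matrix. -/
def weyrSumPerm : WeyrSumIdx n ≃ Σ k : Σ a, Fin (l a), Fin (n k.1 k.2) :=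
  (ofLex.trans (Equiv.sigmaCongrRight fun a => (weyrPerm (n a)).symm)).trans
    (Equiv.sigmaAssoc fun a i => Fin (n a i)).symm

/-- Labelling Jordan blocks by pairs (eigenvalue index, block) flattens the nested direct sum, so
the general results apply to all eigenvalues at once. -/
theorem weyrForm_eq_submatrix :
    weyrForm n lam = (jordanSum (fun k : Σ a, Fin (l a) => n k.1 k.2)
      fun k => lam k.1).submatrix (weyrSumPerm n) (weyrSumPerm n) := by
  ext p q
  obtain ⟨a, x⟩ := p
  obtain ⟨a', y⟩ := q
  obtain ⟨⟨i, j⟩, rfl⟩ := (weyrPerm (n a)).surjective x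
  obtain ⟨⟨i', j'⟩, rfl⟩ := (weyrPerm (n a')).surjective y
  change _ = Matrix.blockDiagonal' (fun k : Σ a, Fin (l a) => jordanBlock (n k.1 k.2) (lam k.1))
    ⟨⟨a, i⟩, j⟩ ⟨⟨a', i'⟩, j'⟩
  by_cases ha : a = a'
  · subst ha
    refine (weyrDirectSum_apply_eq _ a _ _).trans ?_
    change Matrix.blockDiagonal' (fun i => jordanBlock (n a i) (lam a)) ⟨i, j⟩ ⟨i', j'⟩ = _
    by_cases hi : i = i'
    · subst hi
      rw [Matrix.blockDiagonal'_apply_eq]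
      exact (Matrix.blockDiagonal'_apply_eq
        (fun k : Σ a, Fin (l a) => jordanBlock (n k.1 k.2) (lam k.1)) ⟨a, i⟩ j j').symm
    · rw [Matrix.blockDiagonal'_apply_ne _ _ _ hi, Matrix.blockDiagonal'_apply_ne]
      exact fun h => hi (eq_of_heq (Sigma.mk.inj h).2)
  · refine (weyrDirectSum_apply_ne _ ha _ _).trans ?_
    rw [Matrix.blockDiagonal'_apply_ne]
    exact fun h => ha (Sigma.mk.inj h).1

/-- The positions of the parameters in the deformation of the Weyr form. -/
def weyrSumStarPos : (Σ a, Stars (n a)) ↪ WeyrSumIdx n × WeyrSumIdx n where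
  toFun t := (toLex ⟨t.1, (weyrStarPos (n t.1) t.2).1⟩, toLex ⟨t.1, (weyrStarPos (n t.1) t.2).2⟩)
  inj' := by
    rintro ⟨a, t⟩ ⟨a', t'⟩ h
    obtain ⟨h1, h2⟩ := Prod.ext_iff.1 h
    obtain ⟨rfl, h1⟩ := Sigma.mk.inj (toLex.injective h1)
    have h2 := (Sigma.mk.inj (toLex.injective h2)).2
    have ht : t = t' :=
      (weyrStarPos (n a)).injective (Prod.ext (eq_of_heq h1) (eq_of_heq h2))
    rw [ht]

theorem mem_range_weyrSumStarPos_iff {a a' : Fin τ} (x : WeyrIdx (n a)) (y : WeyrIdx (n a')) :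
    ((toLex ⟨a, x⟩, toLex ⟨a', y⟩) : WeyrSumIdx n × WeyrSumIdx n) ∈
        Set.range (weyrSumStarPos n) ↔
      a = a' ∧ IsStarT (n a _) (n a' _) ((weyrPerm (n a)).symm x).2
        ((weyrPerm (n a')).symm y).2 := by
  constructor
  · rintro ⟨⟨a, t⟩, ht⟩
    obtain ⟨h1, h2⟩ := Prod.ext_iff.1 ht
    obtain ⟨rfl, h1'⟩ := Sigma.mk.inj (toLex.injective h1)
    obtain ⟨rfl, h2'⟩ := Sigma.mk.inj (toLex.injective h2)
    obtain rfl := eq_of_heq h1'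
    obtain rfl := eq_of_heq h2'
    exact ⟨rfl, t.2⟩
  · rintro ⟨rfl, h⟩
    exact ⟨⟨a, ⟨((weyrPerm (n a)).symm x, (weyrPerm (n a)).symm y), h⟩⟩, rfl⟩

-- Distinctness of the eigenvalues excludes stars between different summands.
variable {lam} in
theorem mem_range_weyrSumStarPos (hlam : Function.Injective lam) (p q : WeyrSumIdx n) :
    (p, q) ∈ Set.range (weyrSumStarPos n) ↔
      IsArnoldStar (fun k : Σ a, Fin (l a) => n k.1 k.2) (fun k => lam k.1) (weyrSumPerm n p)
        (weyrSumPerm n q) := by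
  obtain ⟨a, x⟩ := p
  obtain ⟨a', y⟩ := q
  refine (mem_range_weyrSumStarPos_iff n x y).trans ?_
  exact and_congr_left' hlam.eq_iff.symm

theorem weyrDeformation_sub (α : (Σ a, Stars (n a)) → ℂ) :
    weyrDeformation n lam α - weyrForm n lam =
      weyrDirectSum n fun a => weyrArnoldMatrix (n a) fun t => α ⟨a, t⟩ := by
  rw [sub_eq_iff_eq_add']
  ext p q
  rw [Matrix.add_apply]
  obtain ⟨a, x⟩ := p
  obtain ⟨a', y⟩ := q
  by_cases ha : a = a'
  · subst ha
    refine (weyrDirectSum_apply_eq _ a x y).trans ?_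
    exact congrArg₂ (· + ·)
      (weyrDirectSum_apply_eq (fun a => weyrMatrix (n a) (lam a)) a x y).symm
      (weyrDirectSum_apply_eq (fun a => weyrArnoldMatrix (n a) fun t => α ⟨a, t⟩) a x y).symm
  · refine (weyrDirectSum_apply_ne _ ha x y).trans ((add_zero 0).symm.trans ?_)
    exact congrArg₂ (· + ·)
      (weyrDirectSum_apply_ne (fun a => weyrMatrix (n a) (lam a)) ha x y).symm
      (weyrDirectSum_apply_ne (fun a => weyrArnoldMatrix (n a) fun t => α ⟨a, t⟩) ha x y).symm

theorem isSimpleAt_weyrDeformation :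
    IsSimpleAt (weyrForm n lam) (weyrDeformation n lam) (weyrSumStarPos n) := by
  intro α
  rw [weyrDeformation_sub]
  refine ⟨?_, ?_⟩
  · rintro ⟨a, t⟩
    exact (weyrDirectSum_apply_eq _ a _ _).trans (weyrArnoldMatrix_weyrStarPos (n a) _ t)
  · rintro ⟨a, x⟩ ⟨a', y⟩ h
    by_cases ha : a = a'
    · subst ha
      refine (weyrDirectSum_apply_eq _ a x y).trans (weyrArnoldMatrix_eq_zero (n a) _ ?_)
      rintro ⟨t, ht⟩
      obtain ⟨rfl, rfl⟩ := Prod.ext_iff.1 ht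
      exact h ⟨⟨a, t⟩, rfl⟩
    · exact weyrDirectSum_apply_ne _ ha x y

theorem strictMono_weyrPosition_weyrSumPerm :
    StrictMono fun p : WeyrSumIdx n =>
      weyrPosition (fun k => (k.1 : ℕ)) (fun k : Σ a, Fin (l a) => (k.2 : ℕ))
        (weyrSumPerm n p) := by
  intro p q hpq
  refine weyrPosition_lt_iff.2 ?_
  rcases hpq with ⟨_, _, h⟩ | ⟨_, _, h⟩
  · exact Or.inl h
  · refine Or.inr ⟨rfl, ?_⟩
    rcases h with ⟨_, _, h⟩ | ⟨_, _, h⟩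
    · exact Or.inl h
    · exact Or.inr ⟨rfl, h⟩

end SeveralEigenvalues

/-! ### The theorem -/

theorem theorem2p2 :
    (∀ (l : ℕ) (n : Fin l → ℕ) (lam : ℂ), Antitone n → (∀ i, 0 < n i) →
      IsMiniversal (weyrMatrix n lam)
        (fun α : Stars n → ℂ => weyrMatrix n lam + weyrArnoldMatrix n α) ∧
      ∃ b : WeyrIdx n → ℕ, IsCoarsestPartition (weyrMatrix n lam) b ∧
        ∀ α : Stars n → ℂ, IsLowerBlockTriangular b (weyrArnoldMatrix n α)) ∧
    (∀ (τ : ℕ) (l : Fin τ → ℕ) (n : ∀ a, Fin (l a) → ℕ) (lam : Fin τ → ℂ),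
      Function.Injective lam → (∀ a, Antitone (n a)) → (∀ a i, 0 < n a i) →
      IsMiniversal (weyrForm n lam) (weyrDeformation n lam) ∧
      IsSimple (weyrForm n lam) (weyrDeformation n lam) ∧
      ∃ b : WeyrSumIdx n → ℕ, IsCoarsestPartition (weyrForm n lam) b ∧
        IsSimpleLowerBlockTriangular b (weyrForm n lam) (weyrDeformation n lam)) := by
  refine ⟨fun l n lam hn _ => ?_, fun τ l n lam hlam hn _ => ?_⟩
  · have hD := isSimpleAt_weyrMatrix_add n lam
    have hpos := mem_range_weyrStarPos n lam
    refine ⟨isMiniversal_of_isSimpleAt_arnoldStars (weyrPerm n).symm hD hpos,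
      weyrStrip (weyrPerm n).symm fun _ => 0,
      isCoarsestPartition_weyrStrip (μ := fun _ => lam) (fun _ _ => by simp) (fun k k' _ h => hn h)
        (strictMono_weyrPosition n), fun α => ?_⟩
    obtain ⟨_, _, h, _⟩ := isSimpleLowerBlockTriangular_weyrStrip (e := (weyrPerm n).symm)
      (g := fun _ => 0) (fun _ _ => by simp) hD hpos
    have := h α
    rwa [← weyrMatrix_eq_submatrix, add_sub_cancel_left] at this
  · have hD := isSimpleAt_weyrDeformation n lam
    have hpos := mem_range_weyrSumStarPos n hlam
    rw [weyrForm_eq_submatrix] at hD ⊢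
    -- The index of the eigenvalue serves as the group label, since `lam` is injective.
    have hg : ∀ k k' : Σ a, Fin (l a), lam k.1 = lam k'.1 ↔ (k.1 : ℕ) = k'.1 := fun k k' => by
      rw [hlam.eq_iff, Fin.ext_iff]
    refine ⟨isMiniversal_of_isSimpleAt_arnoldStars (weyrSumPerm n) hD hpos, ⟨_, hD⟩,
      weyrStrip (weyrSumPerm n) fun k => (k.1 : ℕ), isCoarsestPartition_weyrStrip hg ?_
        (strictMono_weyrPosition_weyrSumPerm n),
      isSimpleLowerBlockTriangular_weyrStrip hg hD hpos⟩
    rintro ⟨a, i⟩ ⟨a', i'⟩ ha hi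
    obtain rfl := Fin.ext ha
    exact hn a hi
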